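/- Let $\Gamma$ be $\mathbb Z$ (discrete theory) or $\mathbb R$ (continuous theory), or more generally any subring of $\mathbb R$. An \emph{Artinian operator} is a formal series $f(D)=\sum_{b\in\Gamma}f_bD^b$ with complex coefficients and well-ordered set of exponents; these form a field $\Lambda^+$. For a finitely supported sequence $\alpha$ of elements of $\Gamma$ (an \emph{order}) let $\mathcal I^\alpha$ be the space of formal series $\sum_{a\in\Gamma}u_a\lambda_a^\alpha$ in the harmonic logarithms of order $\alpha$ whose set of exponents is well-ordered for the reversed order, where $\lambda_a^{(0)}=0$ for negative integers $a$ (all other $\lambda_a^\alpha$ are formal basis elements). The operators act by $D^b\lambda_a^\alpha=\frac{\lfloor a\rceil!}{\lfloor a-b\rceil!}\lambda_{a-b}^\alpha$ and its extension to infinite sums; here $\lfloor a\rceil!=\Gamma(a+1)$ (Gamma function), except $\lfloor a\rceil!=(-1)^{a+1}/(-a-1)!$ for negative integers $a$. On $\mathcal I^{(0)}$ only \emph{differential operators} (all exponents nonnegative integers) are used. $\langle u\rangle_\alpha$ is the coefficient of $\lambda_0^\alpha$ in $u$. A linear operator on $\mathcal I^\alpha$ is \emph{continuous} if it commutes with the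 expansions $u=\sum_a u_a\lambda_a^\alpha$, the image families being summable. Let $S$ be a set of orders containing some $\alpha\neq(0)$ and $\mathcal I_S=\bigoplus_{\alpha\in S}\mathcal I^\alpha$ (so $\mathcal I_S=\mathcal I$ for all orders, $\mathcal I_S=\mathcal I^+$ for all orders $\ne(0)$). A \emph{delta operator} is an Artinian operator of degree one. For a delta operator $f=cD(1+\varepsilon)$, $c\ne0$, $\varepsilon$ with positive exponents only, and $n\in\mathbb Z$, put $f^{b;n}=e^{b(\operatorname{Log}c+2\pi i n)}D^b(1+\varepsilon)^b$. A family $p_a^\alpha\in\mathcal I^\alpha$ ($a\in\Gamma$, $\alpha\in S$) is an \emph{$n$th associated graded sequence} of $f$ if: $p_a^\alpha$ has degree $a$ (unless $\alpha=(0)$ and $a$ is a negative integer); $p_a^\alpha$ is the image of $p_a^\beta$ under $\lambda_c^\beta\mapsto\lambda_c^\alpha$ for all $\beta\neq(0)$ in $S$; $\langle p_0^\alpha\rangle_\alpha=1$ and $\langle p_a^\alpha\rangle_\alpha=0$ for $a\ne0$; and $f^{b;n}p_a^\alpha=\frac{\lfloor a\rceil!}{\lfloor a-b\rceil!}p_{a-b}^\alpha$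 for all $a,b\in\Gamma$ (for $\alpha=(0)$: only for $b$ a nonnegative integer). A \emph{Roman shift} $\sigma_f$ of $f$ is a linear operator on $\mathcal I_S$ that maps each $\mathcal I^\alpha$ continuously to itself and satisfies $\sigma_fp_a^\alpha=p_{a+1}^\alpha$ for $a\neq-1$ and $\sigma_fp_{-1}^\alpha=0$, for some such $p$. The \emph{adjoint} of an operator $\theta$ on $\mathcal I_S$ is the linear map $\theta^*:\Lambda^+\to\Lambda^+$ with $$\langle(\theta^*h)(D)\,u\rangle_\alpha=\langle h(D)\,\theta u\rangle_\alpha\qquad(h\in\Lambda^+,\ (0)\ne\alpha\in S,\ u\in\mathcal I^\alpha).$$ \textbf{Theorem.} Let $f,g$ be delta operators, differential operators if $(0)\in S$ (this is automatic when $\Gamma=\mathbb Z$), and let $\sigma_f,\sigma_g$ be Roman shifts on $\mathcal I_S$ of $f$ and of $g$ (relative to an $n$th and an $m$th associated sequence, for any integers $n,m$). Then the adjoints $\sigma_f^*,\sigma_g^*$ exist and are unique, $$\sigma_f^*h=(\sigma_f^*g)\,(\sigma_g^*h)\quad\text{for every Artinian operator }h,$$ and, as operators on $\mathcal I_S$,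 $$\sigma_f=\sigma_g\circ(\sigma_f^*g)(D).$$ -/

import Mathlib

/-!
Formal series of logarithmic type with exponents in a subring `Γ` of `ℝ`
(`Γ = ℤ` is the discrete theory, `Γ = ℝ` is the continuous theory), Artinian operators,
adjoints and Roman shifts.
-/

noncomputable section

namespace LogSeries

open HahnSeries OrderDual

/-- `a` is a negative integer. -/
def IsNegInt (a : ℝ) : Prop := ∃ k : ℕ, a = -((k : ℝ) + 1)

open scoped Classical in
/-- The Roman factorial: `Γ(a + 1)` when `a` is not a negative integer, and
`(-1)^(a + 1) / (-a - 1)!` when it is (the exponent is written through its parity). -/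
def romanFactorial (a : ℝ) : ℝ :=
  if IsNegInt a then (-1) ^ ⌊-a - 1⌋₊ / (Nat.factorial ⌊-a - 1⌋₊ : ℝ) else Real.Gamma (a + 1)

/-- The Roman number `⌊a⌉`: equal to `a` for `a ≠ 0`, and `⌊0⌉ = 1`. -/
def romanNumber (a : ℝ) : ℝ := if a = 0 then 1 else a

theorem romanFactorial_neg (k : ℕ) :
    romanFactorial (-((k : ℝ) + 1)) = (-1) ^ k / (Nat.factorial k : ℝ) := by
  have h : IsNegInt (-((k : ℝ) + 1)) := ⟨k, rfl⟩
  have e : - -((k : ℝ) + 1) - 1 = k := by ring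
  rw [romanFactorial, if_pos h, e, Nat.floor_natCast]

theorem romanFactorial_ne_zero (a : ℝ) : romanFactorial a ≠ 0 := by
  by_cases h : IsNegInt a
  · obtain ⟨k, rfl⟩ := h
    rw [romanFactorial_neg]
    have : (Nat.factorial k : ℝ) ≠ 0 := by exact_mod_cast Nat.factorial_ne_zero k
    positivity
  · rw [romanFactorial, if_neg h]
    refine Real.Gamma_ne_zero fun m hm => h ⟨m, by linarith⟩

theorem romanFactorial_zero : romanFactorial 0 = 1 := by
  have h : ¬ IsNegInt 0 := by
    rintro ⟨k, hk⟩
    have : (0 : ℝ) ≤ k := Nat.cast_nonneg k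
    linarith
  simp [romanFactorial, h]

theorem romanFactorial_eq (a : ℝ) :
    romanFactorial a = romanNumber a * romanFactorial (a - 1) := by
  by_cases h0 : a = 0
  · subst h0
    have := romanFactorial_neg 0
    simp only [Nat.cast_zero, zero_add, pow_zero, Nat.factorial_zero, Nat.cast_one, div_one] at this
    rw [romanFactorial_zero, romanNumber, if_pos rfl, zero_sub, this, one_mul]
  · rw [romanNumber, if_neg h0]
    by_cases h : IsNegInt a
    · obtain ⟨k, rfl⟩ := h
      have e : -((k : ℝ) + 1) - 1 = -(((k + 1 : ℕ) : ℝ) + 1) := by push_cast; ring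
      rw [e, romanFactorial_neg, romanFactorial_neg, Nat.factorial_succ]
      have : (Nat.factorial k : ℝ) ≠ 0 := by exact_mod_cast Nat.factorial_ne_zero k
      have h1 : ((k : ℝ) + 1) ≠ 0 := by positivity
      push_cast
      field_simp
      ring
    · have h' : ¬ IsNegInt (a - 1) := by
        rintro ⟨k, hk⟩
        rcases k with _ | k
        · exact h0 (by simpa using hk)
        · exact h ⟨k, by push_cast at hk; linarith⟩
      rw [romanFactorial, romanFactorial, if_neg h, if_neg h', sub_add_cancel,
        Real.Gamma_add_one h0]

/-- Artinian operators `f(D) = ∑ f_b D^b`: complex coefficients, exponents in `Γ`, and a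
well-ordered set of exponents. -/
abbrev Artinian (Γ : Subring ℝ) : Type := HahnSeries Γ ℂ

/-- Noetherian families of coefficients `(u_a)_{a ∈ Γ}`: the exponents `a` with `u_a ≠ 0` form a
set that is well-ordered for the reversed order. -/
abbrev Noetherian (Γ : Subring ℝ) : Type := HahnSeries (Γ)ᵒᵈ ℂ

variable {Γ : Subring ℝ}

/-- The linear bijection that sends the series `∑ u_a λ_a` to `∑ ⌊a⌉! u_a D^(-a)`. -/
def dualEquiv : Noetherian Γ ≃ₗ[ℂ] Artinian Γ where
  toFun u :=
    { coeff := fun b => (romanFactorial (((-b : Γ) : Γ) : ℝ) : ℂ) * u.coeff (toDual (-b))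
      isPWO_support' := by
        have h : (Function.support fun b : Γ =>
            (romanFactorial (((-b : Γ) : Γ) : ℝ) : ℂ) * u.coeff (toDual (-b))) ⊆
            (fun x : (Γ)ᵒᵈ => -(ofDual x)) '' u.support := by
          intro b hb
          refine ⟨toDual (-b), fun h0 => hb ?_, by simp⟩
          change _ * u.coeff (toDual (-b)) = 0
          rw [h0, mul_zero]
        refine (u.isPWO_support.image_of_monotone ?_).mono h
        intro x y hxy
        exact neg_le_neg (ofDual_le_ofDual.mpr hxy) }
  invFun v :=
    { coeff := fun a => ((romanFactorial ((ofDual a : Γ) : ℝ) : ℂ))⁻¹ * v.coeff (-(ofDual a))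
      isPWO_support' := by
        have h : (Function.support fun a : (Γ)ᵒᵈ =>
            ((romanFactorial ((ofDual a : Γ) : ℝ) : ℂ))⁻¹ * v.coeff (-(ofDual a))) ⊆
            (fun x : Γ => toDual (-x)) '' v.support := by
          intro b hb
          refine ⟨-(ofDual b), fun h0 => hb ?_, by simp⟩
          change _ * v.coeff (-(ofDual b)) = 0
          rw [h0, mul_zero]
        refine (v.isPWO_support.image_of_monotone ?_).mono h
        intro x y hxy
        exact toDual_le_toDual.mpr (neg_le_neg hxy) }
  map_add' u v := by ext b; simp [mul_add]
  map_smul' c u := by ext b; simp [mul_left_comm]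
  left_inv u := by
    ext a
    have : (romanFactorial ((ofDual a : Γ) : ℝ) : ℂ) ≠ 0 := by
      exact_mod_cast romanFactorial_ne_zero _
    simp [this]
  right_inv v := by
    ext b
    have : (romanFactorial (-(b : ℝ)) : ℂ) ≠ 0 := by
      exact_mod_cast romanFactorial_ne_zero _
    simp [this]

/-- Multiplication by `f` on Artinian operators. -/
def mulOp (f : Artinian Γ) : Artinian Γ →ₗ[ℂ] Artinian Γ where
  toFun v := f * v
  map_add' := mul_add f
  map_smul' c v := by
    rw [← single_zero_mul_eq_smul, ← single_zero_mul_eq_smul, RingHom.id_apply, mul_left_comm]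

/-- The action of an Artinian operator on series in harmonic logarithms, which is
`D^b λ_a = (⌊a⌉! / ⌊a - b⌉!) λ_(a-b)` (see `applyOp_single`), extended to infinite sums. -/
def applyOp (f : Artinian Γ) : Noetherian Γ →ₗ[ℂ] Noetherian Γ :=
  dualEquiv.symm.toLinearMap ∘ₗ mulOp f ∘ₗ dualEquiv.toLinearMap

theorem dualEquiv_single (a : Γ) (c : ℂ) :
    dualEquiv (single (toDual a) c : Noetherian Γ) =
      single (-a) ((romanFactorial (a : ℝ) : ℂ) * c) := by
  ext b
  change (romanFactorial (((-b : Γ) : Γ) : ℝ) : ℂ) *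
    (single (toDual a) c : Noetherian Γ).coeff (toDual (-b)) = _
  by_cases h : b = -a
  · subst h; simp
  · have h2 : toDual (-b) ≠ toDual a := fun e => h (by rw [← toDual.injective e, neg_neg])
    rw [coeff_single_of_ne h2, coeff_single_of_ne h, mul_zero]

theorem applyOp_single (a b : Γ) :
    applyOp (single b 1) (single (toDual a) 1 : Noetherian Γ) =
      single (toDual (a - b)) ((romanFactorial a / romanFactorial ((a - b : Γ) : ℝ) : ℝ) : ℂ) := by
  have h : (romanFactorial ((a - b : Γ) : ℝ) : ℂ) ≠ 0 := by
    exact_mod_cast romanFactorial_ne_zero _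
  apply dualEquiv.injective
  simp only [applyOp, LinearMap.comp_apply, LinearEquiv.coe_coe, LinearEquiv.apply_symm_apply,
    mulOp, LinearMap.coe_mk, AddHom.coe_mk, dualEquiv_single, single_mul_single]
  rw [show b + -a = -(a - b) by ring]
  congr 1
  · push_cast at h ⊢
    field_simp

/-- `D λ_a = ⌊a⌉ λ_(a-1)`. -/
theorem applyOp_D (a : Γ) :
    applyOp (single 1 1) (single (toDual a) 1 : Noetherian Γ) =
      single (toDual (a - 1)) ((romanNumber a : ℝ) : ℂ) := by
  rw [applyOp_single, romanFactorial_eq]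
  have : romanFactorial ((a - 1 : Γ) : ℝ) ≠ 0 := romanFactorial_ne_zero _
  push_cast at this ⊢
  rw [mul_div_assoc, div_self (by exact_mod_cast this), mul_one]

/-- Orders `α` of iterated logarithms: finitely supported sequences of exponents of
`log x, log log x, …`. -/
abbrev LogOrder (Γ : Subring ℝ) : Type := ℕ →₀ Γ

variable (Γ) in
/-- The space of formal series `∑ u_a λ_a^α` in the harmonic logarithms of order `α`.
As `λ_a^(0) = 0` for negative integers `a`, these exponents do not occur when `α = (0)`. -/
def Component (α : LogOrder Γ) : Submodule ℂ (Noetherian Γ) where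
  carrier := {u | α = 0 → ∀ a : Γ, IsNegInt a → u.coeff (toDual a) = 0}
  add_mem' hu hv h0 a ha := by simp [hu h0 a ha, hv h0 a ha]
  zero_mem' _ _ _ := rfl
  smul_mem' c u hu h0 a ha := by simp [hu h0 a ha]

open scoped Classical in
/-- The map `λ_a ↦ λ_a^α`; for `α = (0)` it drops the negative integers `a`. -/
def toOrder (α : LogOrder Γ) : Noetherian Γ →ₗ[ℂ] Component Γ α where
  toFun u :=
    ⟨{ coeff := fun a => if α = 0 ∧ IsNegInt (ofDual a : Γ) then 0 else u.coeff a
       isPWO_support' := u.isPWO_support.mono fun a ha h0 => ha (by simp [h0]) },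
      fun h0 a ha => by simp [h0, ha]⟩
  map_add' u v := by
    apply Subtype.ext
    ext a
    by_cases h : α = 0 ∧ IsNegInt (ofDual a : Γ) <;> simp [h]
  map_smul' c u := by
    apply Subtype.ext
    ext a
    by_cases h : α = 0 ∧ IsNegInt (ofDual a : Γ) <;> simp [h]

/-- The harmonic logarithm `λ_a^α`. -/
def harmonicLog (α : LogOrder Γ) (a : Γ) : Component Γ α := toOrder α (single (toDual a) 1)

/-- The skip operator `λ_a^β ↦ λ_a^α`. -/
def skip (α β : LogOrder Γ) : Component Γ β →ₗ[ℂ] Component Γ α :=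
  toOrder α ∘ₗ (Component Γ β).subtype

/-- The operator `f(D)` on the component of order `α`. For `α = (0)` it is meant for differential
operators only. -/
def applyComp (f : Artinian Γ) (α : LogOrder Γ) : Component Γ α →ₗ[ℂ] Component Γ α :=
  toOrder α ∘ₗ applyOp f ∘ₗ (Component Γ α).subtype

/-- The direct sum of the components with orders in `S`. With `S` the set of all orders this is the
logarithmic algebra; with `S` the set of all orders `≠ (0)` it is its part of nonzero orders. -/
abbrev LogSpace (Γ : Subring ℝ) (S : Set (LogOrder Γ)) : Type :=
  DirectSum S fun α => Component Γ (α : LogOrder Γ)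

variable {S : Set (LogOrder Γ)}

open scoped Classical in
/-- The inclusion of a component. -/
def incl (α : S) : Component Γ (α : LogOrder Γ) →ₗ[ℂ] LogSpace Γ S :=
  DirectSum.lof ℂ S (fun α => Component Γ (α : LogOrder Γ)) α

/-- The operator `f(D)` on `LogSpace Γ S`. -/
def applyLog (f : Artinian Γ) : LogSpace Γ S →ₗ[ℂ] LogSpace Γ S :=
  DirectSum.lmap fun α : S => applyComp f (α : LogOrder Γ)

/-- The augmentation `⟨u⟩_α`: the coefficient of `λ_0^α` in `u`. -/
def augment (α : S) (u : LogSpace Γ S) : ℂ := (u α).1.coeff (toDual 0)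

/-- Continuity of a linear operator on a component: it commutes with the (convergent) expansions
in harmonic logarithms, i.e. for every `u = ∑ u_a λ_a^α`, the family `u_a T λ_a^α` is
summable and its sum is `T u`. -/
def IsContinuousOp {α : LogOrder Γ} (T : Component Γ α →ₗ[ℂ] Component Γ α) : Prop :=
  ∀ u : Component Γ α, ∃ s : SummableFamily (Γ)ᵒᵈ ℂ Γ,
    (∀ a : Γ, s a = u.1.coeff (toDual a) • (T (harmonicLog α a)).1) ∧ (T u).1 = s.hsum

/-- Delta operators: Artinian operators of degree one. -/
def IsDelta (f : Artinian Γ) : Prop := f.orderTop = ((1 : Γ) : WithTop Γ)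

/-- Differential operators: all exponents are nonnegative integers. -/
def IsDifferential (f : Artinian Γ) : Prop := ∀ b ∈ f.support, ∃ k : ℕ, b = k

/-- The power `f^(b;n)`. If `f = c D^d (1 + ε)` with `c ≠ 0` and all exponents of `ε` positive, then
`f^(b;n) = exp (b (Log c + 2πin)) D^(db) (1 + ε)^b`, with `(1 + ε)^b` the binomial series. -/
def power (f : Artinian Γ) (n : ℤ) (b : Γ) : Artinian Γ :=
  single (f.order * b)
      (Complex.exp (((b : ℝ) : ℂ) * (Complex.log f.leadingCoeff + 2 * Real.pi * Complex.I * n))) *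
    (SummableFamily.binomialFamily (single (-f.order) f.leadingCoeff⁻¹ * f) ((b : ℝ) : ℂ)).hsum

/-- `p` is the `n`th associated graded sequence of the delta operator `f`
(for the orders in `S`): a graded sequence with
`⟨p_a^α⟩_α = δ_(a,0)` and `f^(b;n) p_a^α = (⌊a⌉! / ⌊a - b⌉!) p_(a-b)^α`. -/
structure IsAssociated (f : Artinian Γ) (n : ℤ)
    (p : ∀ α : S, Γ → Component Γ (α : LogOrder Γ)) : Prop where
  /-- `p_a^α` has degree `a`, except for `α = (0)` and `a` a negative integer. -/
  degree : ∀ (α : S) (a : Γ), ¬ ((α : LogOrder Γ) = 0 ∧ IsNegInt a) →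
    (p α a).1.coeff (toDual a) ≠ 0 ∧ ∀ b : Γ, a < b → (p α a).1.coeff (toDual b) = 0
  regular : ∀ α β : S, (β : LogOrder Γ) ≠ 0 → ∀ a : Γ,
    p α a = skip (α : LogOrder Γ) (β : LogOrder Γ) (p β a)
  augment_zero : ∀ α : S, augment α (incl α (p α 0)) = 1
  augment_ne : ∀ (α : S) (a : Γ), a ≠ 0 → augment α (incl α (p α a)) = 0
  /-- On order `(0)` only the powers with `b` a nonnegative integer act. -/
  apply_power : ∀ (α : S) (a b : Γ), ((α : LogOrder Γ) ≠ 0 ∨ ∃ k : ℕ, b = k) →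
    applyComp (power f n b) α (p α a) =
      ((romanFactorial a / romanFactorial ((a - b : Γ) : ℝ) : ℝ) : ℂ) • p α (a - b)

/-- `σ` is the Roman shift relative to the graded sequence `p`: on each component it is
continuous, and it sends `p_a^α` to `p_(a+1)^α`, except that `p_(-1)^α` goes to `0`. -/
structure IsRomanShift (p : ∀ α : S, Γ → Component Γ (α : LogOrder Γ))
    (σ : LogSpace Γ S →ₗ[ℂ] LogSpace Γ S) : Prop where
  continuous : ∀ α : S, ∃ T : Component Γ (α : LogOrder Γ) →ₗ[ℂ] Component Γ (α : LogOrder Γ),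
    IsContinuousOp T ∧ ∀ u, σ (incl α u) = incl α (T u)
  map_ne : ∀ (α : S) (a : Γ), a ≠ -1 → σ (incl α (p α a)) = incl α (p α (a + 1))
  map_neg_one : ∀ α : S, σ (incl α (p α (-1))) = 0

/-- `A` is the adjoint of the operator `θ`:
`⟨[A h](D) u⟩_α = ⟨h(D) θ u⟩_α` for all Artinian operators `h`, all orders
`α ≠ (0)` and all series `u` of order `α`. -/
def IsAdjoint (θ : LogSpace Γ S →ₗ[ℂ] LogSpace Γ S) (A : Artinian Γ →ₗ[ℂ] Artinian Γ) : Prop :=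
  ∀ (α : S), (α : LogOrder Γ) ≠ 0 → ∀ (h : Artinian Γ) (u : Component Γ (α : LogOrder Γ)),
    augment α (applyLog (A h) (incl α u)) = augment α (applyLog h (θ (incl α u)))

end LogSeries

end

noncomputable section

namespace LogSeries

open HahnSeries OrderDual

variable {Γ : Subring ℝ} {S : Set (LogOrder Γ)}

/-! In the coordinates `dualEquiv`, λ_a becomes ⌊a⌉! D^(-a), so an Artinian operator acts by
multiplication and ⟨h(D)u⟩ becomes the constant coefficient of a product: a nondegenerate residue
pairing. Write θ = D d/dD (`euler`). Since θx never has a constant coefficient, θ is skew for this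
pairing.

The pairings of θf/f with the powers f^b are δ_(b,0), which forces p_a to be ⌊a⌉! f^(-a) θf/f
(`IsAssociated.dualEquiv_eq`). On these series the map v ↦ -θ(v/θf) does what a Roman shift must do.
A continuous operator is determined by its values on the p_a, because each of its coefficient
functionals is pairing with an Artinian operator and the f^b separate such operators. Hence every
Roman shift is `shiftOp f`, whatever the branch n (`IsRomanShift.apply_incl_toOrder`).

Skewness of θ then gives the adjoint h ↦ θh/θf, that is dh/df. The first identity is the chain rule
dh/df = (dg/df)(dh/dg). The second is the cancellation (θg/θf)v/θg = v/θf inside the shift. -/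

/-! ### The Euler derivation and its chain rule for power series -/

/-- The Euler derivation `D · d/dD` on Artinian operators: `D^b ↦ b D^b`. -/
def euler : Artinian Γ →ₗ[ℂ] Artinian Γ where
  toFun x :=
    { coeff := fun b => ((b : ℝ) : ℂ) * x.coeff b
      isPWO_support' := x.isPWO_support.mono fun b hb h0 => hb (by simp [h0]) }
  map_add' x y := by ext b; simp [mul_add]
  map_smul' c x := by ext b; simp [mul_left_comm]

@[simp]
theorem coeff_euler (x : Artinian Γ) (b : Γ) :
    (euler x).coeff b = ((b : ℝ) : ℂ) * x.coeff b := rfl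

theorem support_euler_subset (x : Artinian Γ) : (euler x).support ⊆ x.support :=
  fun b hb h0 => hb (by simp [h0])

theorem euler_mul (x y : Artinian Γ) : euler (x * y) = euler x * y + x * euler y := by
  ext a
  rw [coeff_euler, coeff_add, coeff_mul, coeff_mul_left' x.isPWO_support (support_euler_subset x),
    coeff_mul_right' y.isPWO_support (support_euler_subset y), ← Finset.sum_add_distrib,
    Finset.mul_sum]
  refine Finset.sum_congr rfl fun ij hij => ?_
  rw [← (Finset.mem_antidiagonal.mp hij).2.2]
  push_cast [coeff_euler]
  ring

theorem euler_single (a : Γ) (c : ℂ) :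
    euler (single a c : Artinian Γ) = single 0 ((a : ℝ) : ℂ) * single a c := by
  ext b
  rw [coeff_single_zero_mul, coeff_euler]
  by_cases h : b = a
  · rw [h]
  · simp [coeff_single_of_ne h]

theorem euler_one : euler (1 : Artinian Γ) = 0 := by
  rw [← single_zero_one, euler_single]
  simp

theorem euler_pow (x : Artinian Γ) (n : ℕ) :
    euler (x ^ (n + 1)) = single 0 ((n : ℂ) + 1) * (euler x * x ^ n) := by
  induction n with
  | zero => simp
  | succ n ih =>
    have h : (single 0 (((n + 1 : ℕ) : ℂ) + 1) : Artinian Γ) = single 0 ((n : ℂ) + 1) + 1 := by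
      rw [← single_zero_one, ← single_add]
      push_cast
      rfl
    rw [pow_succ, euler_mul, ih, h]
    ring

/-- Integration by parts. -/
theorem coeff_zero_mul_euler (x y : Artinian Γ) :
    (x * euler y).coeff 0 = -(euler x * y).coeff 0 := by
  have h := congrArg (fun z : Artinian Γ => z.coeff 0) (euler_mul x y)
  simp only [coeff_euler, coeff_add, ZeroMemClass.coe_zero, Complex.ofReal_zero, zero_mul] at h
  linear_combination -h

/-- This is the chain rule, proved term by term from `euler_pow`; positive order of `x` makes both
families of powers summable. -/
theorem euler_heval {x : Artinian Γ} (hx : 0 < x.orderTop) (P : PowerSeries ℂ) :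
    euler (PowerSeries.heval x P) =
      euler x * PowerSeries.heval x (PowerSeries.derivative ℂ P) := by
  rw [PowerSeries.heval_apply, PowerSeries.heval_apply, ← SummableFamily.hsum_smul]
  ext b
  rw [coeff_euler, SummableFamily.coeff_hsum, SummableFamily.coeff_hsum, ← smul_eq_mul,
    smul_finsum]
  -- The constant term is killed by the derivation, so the sum may be reindexed by `n + 1`, matching
  -- the shift in the derivative of `P`.
  have hs : Function.support (fun n : ℕ => ((b : ℝ) : ℂ) •
      ((SummableFamily.powerSeriesFamily x P) n).coeff b) ⊆ Set.range Nat.succ := by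
    intro n hn
    rcases n with _ | n
    · refine absurd ?_ hn
      have h : ((b : ℝ) : ℂ) * (1 : Artinian Γ).coeff b = 0 := by
        rw [← coeff_euler, euler_one, coeff_zero]
      simp only [SummableFamily.powerSeriesFamily_of_orderTop_pos hx, pow_zero, coeff_smul,
        smul_eq_mul]
      linear_combination (PowerSeries.coeff 0 P) * h
    · exact ⟨n, rfl⟩
  rw [← Set.indicator_eq_self.mpr hs, ← finsum_mem_def, finsum_mem_range Nat.succ_injective]
  refine finsum_congr fun n => ?_
  rw [SummableFamily.smul_apply, SummableFamily.powerSeriesFamily_of_orderTop_pos hx,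
    SummableFamily.powerSeriesFamily_of_orderTop_pos hx, PowerSeries.coeff_derivative,
    of_symm_smul_of_eq_mul, ← single_zero_mul_eq_smul, ← single_zero_mul_eq_smul, mul_left_comm,
    coeff_single_zero_mul, coeff_single_zero_mul, smul_eq_mul, mul_left_comm, ← coeff_euler,
    euler_pow, coeff_single_zero_mul]
  ring

theorem derivative_binomialSeries (r : ℂ) :
    PowerSeries.derivative ℂ (PowerSeries.binomialSeries ℂ r) =
      r • PowerSeries.binomialSeries ℂ (r - 1) := by
  ext n
  have h := Ring.choose_smul_choose r (Nat.le_add_left 1 n)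
  simp only [Nat.choose_one_right, Ring.choose_one_right, Nat.add_sub_cancel, nsmul_eq_mul,
    Nat.cast_one] at h
  rw [PowerSeries.coeff_derivative, PowerSeries.coeff_smul, PowerSeries.binomialSeries_coeff,
    PowerSeries.binomialSeries_coeff]
  push_cast at h
  simp only [smul_eq_mul, mul_one]
  linear_combination h

/-! ### Powers of a delta operator and their residues -/

section Delta

variable {f : Artinian Γ}

theorem IsDelta.ne_zero (hf : IsDelta f) : f ≠ 0 := by
  rintro rfl
  rw [IsDelta, orderTop_zero] at hf
  exact WithTop.top_ne_coe hf

theorem IsDelta.order (hf : IsDelta f) : f.order = 1 := by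
  have := order_eq_orderTop_of_ne_zero hf.ne_zero
  rw [hf] at this
  exact WithTop.coe_injective this

theorem IsDelta.leadingCoeff_ne_zero (hf : IsDelta f) : f.leadingCoeff ≠ 0 :=
  HahnSeries.leadingCoeff_ne_zero.mpr hf.ne_zero

theorem IsDelta.single_mul (hf : IsDelta f) :
    single 1 f.leadingCoeff * (single (-1) f.leadingCoeff⁻¹ * f) = f := by
  rw [← mul_assoc, single_mul_single, add_neg_cancel, mul_inv_cancel₀ hf.leadingCoeff_ne_zero,
    single_zero_one, one_mul]

theorem IsDelta.orderTop_sub_one_pos (hf : IsDelta f) :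
    0 < (single (-1) f.leadingCoeff⁻¹ * f - 1 : Artinian Γ).orderTop := by
  rw [orderTop_self_sub_one_pos_iff, orderTop_mul, leadingCoeff_mul, hf, leadingCoeff_of_single,
    orderTop_single (inv_ne_zero hf.leadingCoeff_ne_zero), ← WithTop.coe_add, neg_add_cancel]
  exact ⟨rfl, inv_mul_cancel₀ hf.leadingCoeff_ne_zero⟩

theorem IsDelta.power_eq (hf : IsDelta f) (n : ℤ) (b : Γ) :
    power f n b = single b (Complex.exp (((b : ℝ) : ℂ) *
        (Complex.log f.leadingCoeff + 2 * Real.pi * Complex.I * n))) *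
      PowerSeries.heval (single (-1) f.leadingCoeff⁻¹ * f - 1)
        (PowerSeries.binomialSeries ℂ ((b : ℝ) : ℂ)) := by
  rw [power, hf.order, one_mul, PowerSeries.heval_apply, SummableFamily.binomialFamily]

theorem IsDelta.power_add (hf : IsDelta f) (n : ℤ) (a b : Γ) :
    power f n (a + b) = power f n a * power f n b := by
  rw [hf.power_eq, hf.power_eq, hf.power_eq, mul_mul_mul_comm, single_mul_single, ← map_mul,
    ← PowerSeries.binomialSeries_add, ← Complex.exp_add]
  push_cast
  rw [add_mul]

theorem IsDelta.power_one (hf : IsDelta f) (n : ℤ) : power f n 1 = f := by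
  have h1 : PowerSeries.binomialSeries ℂ (((1 : Γ) : ℝ) : ℂ) = 1 + PowerSeries.X := by
    have := PowerSeries.binomialSeries_nat (R := ℂ) (A := ℂ) 1
    simpa using this
  have h2 : Complex.exp ((((1 : Γ) : ℝ) : ℂ) *
      (Complex.log f.leadingCoeff + 2 * Real.pi * Complex.I * n)) = f.leadingCoeff := by
    rw [OneMemClass.coe_one, Complex.ofReal_one, one_mul, Complex.exp_add,
      Complex.exp_log hf.leadingCoeff_ne_zero, mul_comm _ (n : ℂ), Complex.exp_int_mul_two_pi_mul_I,
      mul_one]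
  rw [hf.power_eq, h1, h2, map_add, map_one, PowerSeries.heval_X _ hf.orderTop_sub_one_pos,
    add_sub_cancel, hf.single_mul]

theorem IsDelta.orderTop_power (hf : IsDelta f) (n : ℤ) (b : Γ) :
    (power f n b).orderTop = (b : WithTop Γ) := by
  have h := SummableFamily.orderTop_hsum_binomialFamily_pos hf.orderTop_sub_one_pos
    (((b : ℝ) : ℂ))
  rw [orderTop_self_sub_one_pos_iff] at h
  rw [power, hf.order, one_mul, orderTop_mul, h.1, orderTop_single (Complex.exp_ne_zero _),
    add_zero]

theorem IsDelta.power_ne_zero (hf : IsDelta f) (n : ℤ) (b : Γ) : power f n b ≠ 0 := by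
  intro h
  have := hf.orderTop_power n b
  rw [h, orderTop_zero] at this
  exact WithTop.top_ne_coe this

theorem IsDelta.power_zero (hf : IsDelta f) (n : ℤ) : power f n 0 = 1 := by
  have := hf.power_add n 0 0
  rw [add_zero] at this
  exact (mul_eq_left₀ (hf.power_ne_zero n 0)).mp this.symm

/-- The chosen power has order opposite to that of `w`, so the constant coefficient is the product
of the two leading coefficients. -/
theorem IsDelta.coeff_zero_power_mul_ne_zero (hf : IsDelta f) (n : ℤ) {w : Artinian Γ}
    (hw : w ≠ 0) : (power f n (-w.order) * w).coeff 0 ≠ 0 := by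
  have ho : (power f n (-w.order)).order = -w.order := by
    have h := order_eq_orderTop_of_ne_zero (hf.power_ne_zero n (-w.order))
    rw [hf.orderTop_power] at h
    exact WithTop.coe_injective h
  have h := coeff_mul_order_add_order (power f n (-w.order)) w
  rw [ho, neg_add_cancel] at h
  rw [h]
  exact mul_ne_zero (HahnSeries.leadingCoeff_ne_zero.mpr (hf.power_ne_zero n _))
    (HahnSeries.leadingCoeff_ne_zero.mpr hw)

/-- The powers of a delta operator separate points for the residue pairing. -/
theorem IsDelta.eq_of_coeff_zero_power_mul (hf : IsDelta f) (n : ℤ) {v w : Artinian Γ}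
    (h : ∀ b, (power f n b * v).coeff 0 = (power f n b * w).coeff 0) : v = w := by
  by_contra hne
  refine hf.coeff_zero_power_mul_ne_zero n (sub_ne_zero.mpr hne) ?_
  rw [mul_sub, coeff_sub, h, sub_self]

/-- Logarithmic differentiation, θ(f^b)/f^b = b θf/f, cleared of denominators. The branch enters
only through a scalar factor, so it plays no role. -/
theorem IsDelta.euler_power (hf : IsDelta f) (n : ℤ) (b : Γ) :
    euler (power f n b) * f = single 0 ((b : ℝ) : ℂ) * (power f n b * euler f) := by
  have key : ∀ (x y : Artinian Γ), euler (single 1 x.leadingCoeff * (y + 1)) =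
      single 1 x.leadingCoeff * (euler y + (y + 1)) := by
    intro x y
    rw [euler_mul, euler_single, map_add, euler_one]
    simp
    ring
  obtain ⟨y, hy⟩ : ∃ y : Artinian Γ, y = single (-1) f.leadingCoeff⁻¹ * f - 1 := ⟨_, rfl⟩
  have hpos := hf.orderTop_sub_one_pos
  have hf' : f = single 1 f.leadingCoeff * (y + 1) := by
    rw [hy, sub_add_cancel, hf.single_mul]
  have hef : euler f = single 1 f.leadingCoeff * (euler y + (y + 1)) := by
    rw [← key, ← hf']
  -- Differentiation lowers the binomial exponent to `b - 1`; splitting off one factor `y + 1`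
  -- expresses both sides through the same series.
  have hB : PowerSeries.heval y (PowerSeries.binomialSeries ℂ ((b : ℝ) : ℂ)) =
      PowerSeries.heval y (PowerSeries.binomialSeries ℂ (((b : ℝ) : ℂ) - 1)) * (y + 1) := by
    have h1 : PowerSeries.binomialSeries ℂ (1 : ℂ) = 1 + PowerSeries.X := by
      simpa using PowerSeries.binomialSeries_nat (R := ℂ) (A := ℂ) 1
    have h2 : PowerSeries.heval y (PowerSeries.binomialSeries ℂ (1 : ℂ)) = y + 1 := by
      rw [h1, map_add, map_one, PowerSeries.heval_X _ (hy ▸ hpos), add_comm]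
    rw [← h2, ← map_mul, ← PowerSeries.binomialSeries_add, sub_add_cancel]
  rw [hf.power_eq, ← hy, euler_mul, euler_single, euler_heval (hy ▸ hpos),
    derivative_binomialSeries, map_smul, ← single_zero_mul_eq_smul, hef, hB]
  generalize (single b (Complex.exp (((b : ℝ) : ℂ) *
    (Complex.log f.leadingCoeff + 2 * Real.pi * Complex.I * n))) : Artinian Γ) = E
  generalize PowerSeries.heval y (PowerSeries.binomialSeries ℂ (((b : ℝ) : ℂ) - 1)) = B
  linear_combination (single 0 ((b : ℝ) : ℂ) * E * (B * (y + 1)) +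
    E * (euler y * (single 0 ((b : ℝ) : ℂ) * B))) * hf'

theorem IsDelta.euler_ne_zero (hf : IsDelta f) : euler f ≠ 0 := by
  intro h
  have h1 : (euler f).coeff f.order ≠ 0 := by
    rw [coeff_euler, hf.order, OneMemClass.coe_one, Complex.ofReal_one, one_mul, ← hf.order]
    exact coeff_order_eq_zero.not.mpr hf.ne_zero
  exact h1 (by rw [h, coeff_zero])

/-- The derivation fixes the leading term of `f`, which has exponent 1, so `euler f - f` has no
exponents `≤ 1`. Its quotient by `f` therefore has no constant coefficient. -/
theorem IsDelta.coeff_zero_euler_div (hf : IsDelta f) : (euler f / f).coeff 0 = 1 := by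
  have hz : (euler f - f) / f * f = euler f - f := div_mul_cancel₀ _ hf.ne_zero
  rw [show euler f / f = (euler f - f) / f + 1 by
    rw [sub_div, div_self hf.ne_zero, sub_add_cancel], coeff_add, coeff_one, if_pos rfl]
  generalize (euler f - f) / f = z at hz
  by_contra h
  have h0 : z.coeff 0 ≠ 0 := fun h0 => h (by rw [h0, zero_add])
  have hz0 : z ≠ 0 := by
    rintro rfl
    exact h0 rfl
  have ho := order_mul hz0 hf.ne_zero
  have hc := coeff_order_eq_zero.not.mpr (mul_ne_zero hz0 hf.ne_zero)
  have hle : (z * f).order ≤ 1 := by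
    rw [ho, hf.order]
    exact add_le_of_nonpos_left (order_le_of_coeff_ne_zero h0)
  rw [hz] at hc hle
  refine hc ?_
  rcases hle.lt_or_eq with hlt | heq
  · have : f.coeff (euler f - f).order = 0 := coeff_eq_zero_of_lt_order (hf.order ▸ hlt)
    rw [coeff_sub, coeff_euler, this, mul_zero, sub_zero]
  · rw [heq, coeff_sub, coeff_euler]
    simp

/-- For `b ≠ 0` the series is θ(f^b)/b, and a derivative under θ has zero constant coefficient. -/
theorem IsDelta.coeff_zero_power_mul_euler_div (hf : IsDelta f) (n : ℤ) (b : Γ) :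
    (power f n b * (euler f / f)).coeff 0 = if b = 0 then 1 else 0 := by
  split_ifs with hb
  · rw [hb, hf.power_zero, one_mul, hf.coeff_zero_euler_div]
  · have h : single 0 ((b : ℝ) : ℂ) * (power f n b * (euler f / f)) = euler (power f n b) := by
      rw [← mul_div_assoc, ← mul_div_assoc, ← hf.euler_power,
        mul_div_cancel_right₀ _ hf.ne_zero]
    have h' := congrArg (fun z : Artinian Γ => z.coeff 0) h
    simp only [coeff_single_zero_mul, coeff_euler, ZeroMemClass.coe_zero, Complex.ofReal_zero,
      zero_mul] at h'
    refine (mul_eq_zero.mp h').resolve_left ?_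
    exact_mod_cast hb

/-- In the coordinates given by `dualEquiv`, the Roman shift of `f` sends `v` to
`-D d/dD (v / (D f'))`; here it is applied to a multiple of `f^b`. -/
theorem IsDelta.euler_power_mul_div (hf : IsDelta f) (n : ℤ) (b : Γ) :
    -euler (power f n b * (euler f / f) / euler f) =
      single 0 (1 - ((b : ℝ) : ℂ)) * (power f n (b - 1) * (euler f / f)) := by
  have h1 : power f n b = power f n (b - 1) * f := by
    have := hf.power_add n (b - 1) 1
    rwa [sub_add_cancel, hf.power_one] at this
  have h2 : power f n b * (euler f / f) / euler f = power f n (b - 1) := by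
    rw [h1]
    field_simp [hf.ne_zero, hf.euler_ne_zero]
  have h3 : euler (power f n (b - 1)) =
      single 0 (((b - 1 : Γ) : ℝ) : ℂ) * (power f n (b - 1) * (euler f / f)) := by
    rw [← mul_div_assoc, ← mul_div_assoc, ← hf.euler_power, mul_div_cancel_right₀ _ hf.ne_zero]
  rw [h2, h3, show (1 - ((b : ℝ) : ℂ)) = -(((b - 1 : Γ) : ℝ) : ℂ) by push_cast; ring,
    single_zero_mul_eq_smul, single_zero_mul_eq_smul, neg_smul]

end Delta

/-! ### Dual coordinates, components and continuous functionals -/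

theorem dualEquiv_applyOp (f : Artinian Γ) (u : Noetherian Γ) :
    dualEquiv (applyOp f u) = f * dualEquiv u := by
  simp [applyOp, mulOp]

theorem coeff_dualEquiv (u : Noetherian Γ) (b : Γ) :
    (dualEquiv u).coeff b = (romanFactorial (((-b : Γ) : Γ) : ℝ) : ℂ) * u.coeff (toDual (-b)) :=
  rfl

theorem coeff_dualEquiv_symm (v : Artinian Γ) (a : Γ) :
    (dualEquiv.symm v : Noetherian Γ).coeff (toDual a) =
      ((romanFactorial (a : ℝ) : ℂ))⁻¹ * v.coeff (-a) :=
  rfl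

theorem coeff_zero_dualEquiv (u : Noetherian Γ) :
    (dualEquiv u).coeff 0 = u.coeff (toDual 0) := by
  rw [coeff_dualEquiv, neg_zero, ZeroMemClass.coe_zero, romanFactorial_zero, Complex.ofReal_one,
    one_mul]

open scoped Classical in
theorem coeff_toOrder (α : LogOrder Γ) (u : Noetherian Γ) (a : (Γ)ᵒᵈ) :
    (toOrder α u).1.coeff a = if α = 0 ∧ IsNegInt (ofDual a : Γ) then 0 else u.coeff a :=
  rfl

theorem toOrder_of_ne_zero {α : LogOrder Γ} (hα : α ≠ 0) (u : Noetherian Γ) :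
    (toOrder α u).1 = u := by
  ext a
  rw [coeff_toOrder, if_neg fun h => hα h.1]

theorem toOrder_coe {α : LogOrder Γ} (u : Component Γ α) : toOrder α u.1 = u := by
  apply Subtype.ext
  ext a
  rw [coeff_toOrder]
  split_ifs with h
  · exact (u.2 h.1 _ h.2).symm
  · rfl

theorem harmonicLog_eq_zero {α : LogOrder Γ} {a : Γ} (h : α = 0 ∧ IsNegInt a) :
    harmonicLog α a = 0 := by
  apply Subtype.ext
  ext b
  rw [harmonicLog, coeff_toOrder]
  split_ifs with hb
  · rfl
  · have : b ≠ toDual a := by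
      rintro rfl
      exact hb h
    rw [coeff_single_of_ne this]
    rfl

/-- The coefficient functionals of a continuous operator are represented by Artinian operators
through the pairing `⟨k(D) u⟩`. -/
theorem IsContinuousOp.exists_coeff_eq {α : LogOrder Γ} {T : Component Γ α →ₗ[ℂ] Component Γ α}
    (hT : IsContinuousOp T) (d : (Γ)ᵒᵈ) :
    ∃ k : Artinian Γ, ∀ u : Noetherian Γ,
      (T (toOrder α u)).1.coeff d = (k * dualEquiv u).coeff 0 := by
  obtain ⟨c, hc⟩ : ∃ c : Γ → ℂ, ∀ a, c a = (T (harmonicLog α a)).1.coeff d := ⟨_, fun _ => rfl⟩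
  have hsum : ∀ u : Noetherian Γ, (Function.support fun a : Γ => u.coeff (toDual a) * c a).Finite ∧
      (T (toOrder α u)).1.coeff d = ∑ᶠ a : Γ, u.coeff (toDual a) * c a := by
    intro u
    obtain ⟨s, hs, hTs⟩ := hT (toOrder α u)
    have hsc : ∀ a : Γ, (s a).coeff d = u.coeff (toDual a) * c a := by
      intro a
      rw [hs, coeff_smul, smul_eq_mul, hc, coeff_toOrder]
      split_ifs with h
      · rw [harmonicLog_eq_zero (ofDual_toDual a ▸ h), map_zero, zero_mul]
        exact (mul_zero _).symm
      · rfl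
    refine ⟨?_, ?_⟩
    · have := SummableFamily.finite_co_support s d
      simp only [hsc] at this
      exact this
    · rw [hTs, SummableFamily.coeff_hsum]
      exact finsum_congr hsc
  -- A strictly decreasing sequence in the support would be the exponent set of a legitimate series
  -- with all coefficients 1, and its image family would not be summable at `d`.
  have hPWO : (Function.support c).IsPWO := by
    rw [Set.isPWO_iff_isWF, Set.isWF_iff_no_descending_seq]
    intro x hx hmem
    have hr : (Set.range fun i => toDual (x i)).IsPWO := by
      rw [← Set.image_univ]
      exact (Set.isPWO_of_wellQuasiOrderedLE _).image_of_monotone fun i j hij =>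
        toDual_le_toDual.mpr (hx.antitone hij)
    classical
    obtain ⟨u, hu⟩ : ∃ u : Noetherian Γ, ∀ i, u.coeff (toDual (x i)) = 1 :=
      ⟨⟨(Set.range fun i => toDual (x i)).indicator 1,
        hr.mono Set.support_indicator_subset⟩, fun i => by simp⟩
    refine Set.infinite_range_of_injective hx.injective ((hsum u).1.subset ?_)
    rintro _ ⟨i, rfl⟩
    rw [Function.mem_support, hu, one_mul]
    exact hmem _
  have hR : ∀ a : Γ, (romanFactorial (a : ℝ) : ℂ) ≠ 0 := fun a => by
    exact_mod_cast romanFactorial_ne_zero _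
  -- Dividing by ⌊a⌉! compensates the factor that `dualEquiv` puts on λ_a.
  obtain ⟨k, hk⟩ : ∃ k : Artinian Γ, ∀ a : Γ,
      k.coeff a = c a * ((romanFactorial (a : ℝ) : ℂ))⁻¹ :=
    ⟨⟨fun a => c a * ((romanFactorial (a : ℝ) : ℂ))⁻¹,
      hPWO.mono fun a ha h0 => ha (by simp [h0])⟩, fun _ => rfl⟩
  refine ⟨k, fun u => ?_⟩
  classical
  have hs : (Function.support fun a : Γ => u.coeff (toDual a) * c a) ⊆
      Finset.image Prod.fst
        (Finset.antidiagonal k.isPWO_support (dualEquiv u).isPWO_support 0) := by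
    refine fun a ha => Finset.mem_coe.mpr (Finset.mem_image.mpr ⟨(a, -a), ?_, rfl⟩)
    rw [Finset.mem_antidiagonal]
    refine ⟨?_, ?_, add_neg_cancel a⟩
    · rw [mem_support, hk]
      exact mul_ne_zero (right_ne_zero_of_mul ha) (inv_ne_zero (hR a))
    · rw [mem_support, coeff_dualEquiv, neg_neg]
      exact mul_ne_zero (hR a) (left_ne_zero_of_mul ha)
  rw [(hsum u).2, coeff_mul, finsum_eq_sum_of_support_subset _ hs, Finset.sum_image]
  · refine Finset.sum_congr rfl fun ij hij => ?_
    have h := eq_neg_of_add_eq_zero_right (Finset.mem_antidiagonal.mp hij).2.2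
    rw [h, hk, coeff_dualEquiv, neg_neg]
    have := hR ij.1
    field_simp
  · rintro ⟨i, j⟩ hij ⟨i', j'⟩ hij' (rfl : i = i')
    have h := (Finset.mem_antidiagonal.mp hij).2.2
    have h' := (Finset.mem_antidiagonal.mp hij').2.2
    exact Prod.ext rfl (add_left_cancel (h.trans h'.symm))

theorem mul_neg_artinian (x y : Artinian Γ) : x * -y = -(x * y) := by
  refine eq_neg_of_add_eq_zero_left ?_
  rw [← mul_add, neg_add_cancel, mul_zero]

theorem incl_apply_same (α : S) (u : Component Γ (α : LogOrder Γ)) : incl α u α = u := by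
  classical
  rw [incl, DirectSum.lof_apply]

theorem incl_injective (α : S) : Function.Injective (incl (Γ := Γ) α) := fun u v h => by
  rw [← incl_apply_same α u, h, incl_apply_same]

theorem applyLog_incl (f : Artinian Γ) (α : S) (u : Component Γ (α : LogOrder Γ)) :
    applyLog f (incl α u) = incl α (applyComp f α u) := by
  classical
  exact DirectSum.lmap_lof _ _ _

theorem augment_applyLog_incl {α : S} (hα : (α : LogOrder Γ) ≠ 0) (h : Artinian Γ)
    (u : Component Γ (α : LogOrder Γ)) :
    augment α (applyLog h (incl α u)) = (h * dualEquiv u.1).coeff 0 := by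
  rw [applyLog_incl, augment, incl_apply_same, applyComp, LinearMap.comp_apply,
    toOrder_of_ne_zero hα, ← coeff_zero_dualEquiv, LinearMap.comp_apply, dualEquiv_applyOp]
  rfl

/-! ### Associated sequences and Roman shifts -/

/-- The series `⌊a⌉! f^(-a) D f' / f` correspond to the associated sequence of `f`. -/
theorem IsAssociated.dualEquiv_eq {f : Artinian Γ} {n : ℤ}
    {p : ∀ α : S, Γ → Component Γ (α : LogOrder Γ)} (hf : IsDelta f) (hp : IsAssociated f n p)
    {β : S} (hβ : (β : LogOrder Γ) ≠ 0) (a : Γ) :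
    dualEquiv (p β a).1 =
      single 0 (romanFactorial (a : ℝ) : ℂ) * (power f n (-a) * (euler f / f)) := by
  have key : ∀ b : Γ, power f n b * dualEquiv (p β 0).1 =
      single 0 ((romanFactorial ((-b : Γ) : ℝ) : ℂ))⁻¹ * dualEquiv (p β (-b)).1 := by
    intro b
    have h := congrArg (fun x => dualEquiv x.1) (hp.apply_power β 0 b (Or.inl hβ))
    simp only [applyComp, LinearMap.comp_apply, toOrder_of_ne_zero hβ, dualEquiv_applyOp,
      zero_sub, ZeroMemClass.coe_zero, romanFactorial_zero, one_div, Submodule.coe_smul,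
      Submodule.subtype_apply, Complex.ofReal_inv] at h
    rw [single_zero_mul_eq_smul]
    exact h.trans (map_smul dualEquiv _ _)
  -- The augmentation conditions say that both sides have the same pairing, δ_(b,0), with every f^b.
  have h0 : dualEquiv (p β 0).1 = euler f / f := by
    refine hf.eq_of_coeff_zero_power_mul n fun b => ?_
    rw [hf.coeff_zero_power_mul_euler_div, key, coeff_single_zero_mul, coeff_zero_dualEquiv]
    have h1 : ∀ a, augment β (incl β (p β a)) = (p β a).1.coeff (toDual 0) := fun a => by
      rw [augment, incl_apply_same]
    split_ifs with hb
    · rw [hb, neg_zero, ← h1, hp.augment_zero, ZeroMemClass.coe_zero, romanFactorial_zero]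
      simp
    · rw [← h1, hp.augment_ne β _ (neg_ne_zero.mpr hb), mul_zero]
  have hR : (romanFactorial (a : ℝ) : ℂ) ≠ 0 := by
    exact_mod_cast romanFactorial_ne_zero _
  have h := key (-a)
  rw [neg_neg, h0] at h
  rw [h, ← mul_assoc, single_mul_single, add_zero, mul_inv_cancel₀ hR, single_zero_one, one_mul]

theorem IsAssociated.eq_toOrder {f : Artinian Γ} {n : ℤ}
    {p : ∀ α : S, Γ → Component Γ (α : LogOrder Γ)} (hp : IsAssociated f n p)
    {β : S} (hβ : (β : LogOrder Γ) ≠ 0) (α : S) (a : Γ) :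
    p α a = toOrder α (p β a).1 :=
  hp.regular α β hβ a

/-- The Roman shift of `f` on series in formal symbols `λ_a`: in the coordinates given by
`dualEquiv` it is `v ↦ -D d/dD (v / (D f'))`. -/
def shiftOp (f : Artinian Γ) (u : Noetherian Γ) : Noetherian Γ :=
  dualEquiv.symm (-euler (dualEquiv u / euler f))

/-- The shift produces the factor (a + 1)⌊a⌉!, which is ⌊a + 1⌉! unless a = -1, where it vanishes.
-/
theorem IsAssociated.shiftOp_eq {f : Artinian Γ} {n : ℤ}
    {p : ∀ α : S, Γ → Component Γ (α : LogOrder Γ)} (hf : IsDelta f) (hp : IsAssociated f n p)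
    {β : S} (hβ : (β : LogOrder Γ) ≠ 0) (a : Γ) :
    shiftOp f (p β a).1 = if a = -1 then 0 else (p β (a + 1)).1 := by
  have h : -euler (dualEquiv (p β a).1 / euler f) =
      single 0 ((((a : ℝ) + 1) * romanFactorial (a : ℝ) : ℝ) : ℂ) *
        (power f n (-(a + 1)) * (euler f / f)) := by
    have hc : ∀ (c : ℂ) (x : Artinian Γ), euler (single 0 c * x) = single 0 c * euler x := by
      intro c x
      rw [single_zero_mul_eq_smul, single_zero_mul_eq_smul, map_smul]
    rw [hp.dualEquiv_eq hf hβ, mul_div_assoc, hc, ← mul_neg_artinian, hf.euler_power_mul_div, ← mul_assoc,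
      single_mul_single, neg_add, ← sub_eq_add_neg, add_zero]
    congr 2
    push_cast
    ring_nf
  rw [shiftOp, LinearEquiv.symm_apply_eq, h]
  split_ifs with ha
  · rw [ha]
    simp
  · rw [hp.dualEquiv_eq hf hβ, romanFactorial_eq ((a + 1 : Γ) : ℝ), romanNumber, if_neg]
    · push_cast
      rw [add_sub_cancel_right]
    · intro h
      exact ha (eq_neg_of_add_eq_zero_left (by exact_mod_cast h))

/-- Every Roman shift of `f` is given on all components by `shiftOp f`. -/
theorem IsRomanShift.apply_incl_toOrder {f : Artinian Γ} {n : ℤ}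
    {p : ∀ α : S, Γ → Component Γ (α : LogOrder Γ)} {σ : LogSpace Γ S →ₗ[ℂ] LogSpace Γ S}
    (hS : ∃ β : S, (β : LogOrder Γ) ≠ 0) (hf : IsDelta f) (hp : IsAssociated f n p)
    (hσ : IsRomanShift p σ) (α : S) (u : Noetherian Γ) :
    σ (incl α (toOrder α u)) = incl α (toOrder α (shiftOp f u)) := by
  obtain ⟨β, hβ⟩ := hS
  obtain ⟨T, hT, hσT⟩ := hσ.continuous α
  have hp' : ∀ a, T (toOrder α (p β a).1) = toOrder α (shiftOp f (p β a).1) := by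
    intro a
    apply incl_injective α
    rw [hp.shiftOp_eq hf hβ, ← hσT, ← hp.eq_toOrder hβ]
    split_ifs with ha
    · rw [ha, hσ.map_neg_one, map_zero, map_zero]
    · rw [hσ.map_ne α a ha, hp.eq_toOrder hβ α (a + 1)]
  rw [hσT]
  congr 1
  apply Subtype.ext
  ext d
  obtain ⟨d, rfl⟩ := toDual.surjective d
  by_cases hd : (α : LogOrder Γ) = 0 ∧ IsNegInt d
  · rw [(T _).2 hd.1 d hd.2, (toOrder _ _).2 hd.1 d hd.2]
  have hR : ∀ a : Γ, (romanFactorial (a : ℝ) : ℂ) ≠ 0 := fun a => by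
    exact_mod_cast romanFactorial_ne_zero _
  obtain ⟨k, hk⟩ := hT.exists_coeff_eq (toDual d)
  obtain ⟨k', hk'⟩ : ∃ k' : Artinian Γ, ∀ u : Noetherian Γ,
      (toOrder (α : LogOrder Γ) (shiftOp f u)).1.coeff (toDual d) =
        (k' * dualEquiv u).coeff 0 := by
    -- Extracting the coefficient at `d` is pairing with a multiple of D^d; integration by parts
    -- moves the derivation onto that monomial.
    refine ⟨euler (single d ((romanFactorial (d : ℝ) : ℂ))⁻¹) / euler f, fun u => ?_⟩
    rw [coeff_toOrder, ofDual_toDual, if_neg hd, shiftOp, coeff_dualEquiv_symm, div_mul_eq_mul_div,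
      mul_div_assoc, ← neg_neg (HahnSeries.coeff _ 0), ← coeff_zero_mul_euler, ← coeff_neg,
      ← mul_neg_artinian, coeff_single_mul, zero_sub]
  -- Both functionals agree on the p_(-b), which are nonzero multiples of f^b θf/f, and the f^b
  -- separate points.
  have hkk : k * (euler f / f) = k' * (euler f / f) := by
    refine hf.eq_of_coeff_zero_power_mul n fun b => ?_
    have h := (hk (p β (-b)).1).symm.trans
      ((congrArg (fun x => x.1.coeff (toDual d)) (hp' (-b))).trans (hk' _))
    rw [hp.dualEquiv_eq hf hβ, neg_neg, mul_left_comm, coeff_single_zero_mul, mul_left_comm k',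
      coeff_single_zero_mul] at h
    rw [mul_left_comm, mul_left_comm _ k']
    exact mul_left_cancel₀ (hR _) h
  rw [hk, hk', mul_right_cancel₀ (div_ne_zero hf.euler_ne_zero hf.ne_zero) hkk]

/-! ### Adjoints and the chain rule -/

/-- The derivation `h ↦ dh/df`. -/
def derivOver (f : Artinian Γ) : Artinian Γ →ₗ[ℂ] Artinian Γ where
  toFun h := euler h / euler f
  map_add' x y := by rw [map_add, add_div]
  map_smul' c x := by
    rw [map_smul, ← single_zero_mul_eq_smul, ← single_zero_mul_eq_smul, mul_div_assoc]
    rfl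

theorem derivOver_apply (f h : Artinian Γ) : derivOver f h = euler h / euler f := rfl

/-- The adjoint of a Roman shift of `f` is `d/df`. -/
theorem IsRomanShift.isAdjoint {f : Artinian Γ} {n : ℤ}
    {p : ∀ α : S, Γ → Component Γ (α : LogOrder Γ)} {σ : LogSpace Γ S →ₗ[ℂ] LogSpace Γ S}
    (hf : IsDelta f) (hp : IsAssociated f n p) (hσ : IsRomanShift p σ) :
    IsAdjoint σ (derivOver f) := by
  intro α hα h u
  have hs := hσ.apply_incl_toOrder ⟨α, hα⟩ hf hp α u.1
  rw [toOrder_coe] at hs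
  rw [hs, augment_applyLog_incl hα, augment_applyLog_incl hα, toOrder_of_ne_zero hα, shiftOp,
    LinearEquiv.apply_symm_apply, mul_neg_artinian, coeff_neg, coeff_zero_mul_euler, neg_neg,
    derivOver_apply, div_mul_eq_mul_div, mul_div_assoc]

theorem IsAdjoint.unique (hS : ∃ β : S, (β : LogOrder Γ) ≠ 0)
    {θ : LogSpace Γ S →ₗ[ℂ] LogSpace Γ S} {A B : Artinian Γ →ₗ[ℂ] Artinian Γ}
    (hA : IsAdjoint θ A) (hB : IsAdjoint θ B) : A = B := by
  obtain ⟨β, hβ⟩ := hS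
  ext1 h
  have key : ∀ v : Artinian Γ, (A h * v).coeff 0 = (B h * v).coeff 0 := by
    intro v
    have hv : dualEquiv (toOrder (β : LogOrder Γ) (dualEquiv.symm v)).1 = v := by
      rw [toOrder_of_ne_zero hβ, LinearEquiv.apply_symm_apply]
    generalize toOrder (β : LogOrder Γ) (dualEquiv.symm v) = u at hv
    rw [← hv, ← augment_applyLog_incl hβ, ← augment_applyLog_incl hβ, hA β hβ, hB β hβ]
  ext b
  -- Pairing with D^(-b) reads off the coefficient at `b`.
  have := key (single (-b) 1)
  simpa [coeff_mul_single] using this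

theorem shiftOp_applyOp_derivOver {f g : Artinian Γ} (hg : IsDelta g) (u : Noetherian Γ) :
    shiftOp g (applyOp (derivOver f g) u) = shiftOp f u := by
  have := hg.euler_ne_zero
  rw [shiftOp, shiftOp, dualEquiv_applyOp, derivOver_apply]
  congr 3
  field_simp

end LogSeries

end

theorem mainTheorem11 (Γ : Subring ℝ) (S : Set (LogSeries.LogOrder Γ))
    (hS : ∃ α ∈ S, α ≠ 0)
    (f g : LogSeries.Artinian Γ) (hf : LogSeries.IsDelta f) (hg : LogSeries.IsDelta g)
    (h0 : 0 ∈ S → LogSeries.IsDifferential f ∧ LogSeries.IsDifferential g)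
    (n m : ℤ)
    (p q : ∀ α : S, Γ → LogSeries.Component Γ (α : LogSeries.LogOrder Γ))
    (hp : LogSeries.IsAssociated f n p) (hq : LogSeries.IsAssociated g m q)
    (σf σg : LogSeries.LogSpace Γ S →ₗ[ℂ] LogSeries.LogSpace Γ S)
    (hσf : LogSeries.IsRomanShift p σf) (hσg : LogSeries.IsRomanShift q σg) :
    ∃ A B : LogSeries.Artinian Γ →ₗ[ℂ] LogSeries.Artinian Γ,
      (LogSeries.IsAdjoint σf A ∧ ∀ A', LogSeries.IsAdjoint σf A' → A' = A) ∧
      (LogSeries.IsAdjoint σg B ∧ ∀ B', LogSeries.IsAdjoint σg B' → B' = B) ∧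
      (∀ h : LogSeries.Artinian Γ, A h = A g * B h) ∧
      σf = σg ∘ₗ LogSeries.applyLog (A g) := by
  have hS' : ∃ β : S, (β : LogSeries.LogOrder Γ) ≠ 0 := by
    obtain ⟨α, hα, hne⟩ := hS
    exact ⟨⟨α, hα⟩, hne⟩
  have hA := hσf.isAdjoint hf hp
  have hB := hσg.isAdjoint hg hq
  refine ⟨LogSeries.derivOver f, LogSeries.derivOver g,
    ⟨hA, fun A' hA' => LogSeries.IsAdjoint.unique hS' hA' hA⟩,
    ⟨hB, fun B' hB' => LogSeries.IsAdjoint.unique hS' hB' hB⟩, fun h => ?_, ?_⟩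
  · rw [LogSeries.derivOver_apply, LogSeries.derivOver_apply, LogSeries.derivOver_apply, mul_comm,
      div_mul_div_cancel₀ hg.euler_ne_zero]
  · classical
    refine DirectSum.linearMap_ext ℂ fun α => LinearMap.ext fun u => ?_
    change σf (LogSeries.incl α u) =
      σg (LogSeries.applyLog (LogSeries.derivOver f g) (LogSeries.incl α u))
    -- The formula for σ_g holds for an arbitrary series before truncation, so on order (0) the
    -- terms dropped by `toOrder` after applying dg/df do no harm.
    have h := hσg.apply_incl_toOrder hS' hg hq α
      (LogSeries.applyOp (LogSeries.derivOver f g) u.1)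
    rw [LogSeries.shiftOp_applyOp_derivOver hg, ← hσf.apply_incl_toOrder hS' hf hp,
      LogSeries.toOrder_coe] at h
    rw [LogSeries.applyLog_incl, ← h]
    rfl
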